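/- Let $1\le q\le n+1$ and let $\mathbb R^{n+1}_q$ be $\mathbb R^{n+1}$ with coordinates $(x^0,\dots,x^n)$, the metric $\overline g=\sum_i\varepsilon_i(dx^i)^2$, where $\varepsilon_i=\varepsilon^i=-1$ for $i\le q-1$ and $+1$ for $i\ge q$, and its Levi-Civita connection $\overline\nabla$. Let $\mathcal D\subseteq\mathbb R^n$ be open and $F:\mathcal D\to\mathbb R$ smooth and nowhere zero, and suppose that the Monge hypersurface $M=\{(F(u),u^1,\dots,u^n):u\in\mathcal D\}$ is null, i.e. the induced tensor $g$ is degenerate at every point of $M$. Write $F'_a=\partial F/\partial u^a$, summing over repeated indices $a=1,\dots,n$. For a vector field $N$ on a neighbourhood of $M$ that along $M$ is lightlike and transversal to $M$ (a null rigging), let $\eta=\overline g(N,\cdot)|_{TM}$, and let the rigged field $\xi$ be the section of $TM^\perp\subset TM$ with $\overline g(\xi,N)=1$. Decomposing along $TM\oplus\mathrm{span}\,N$, the induced connection $\nabla$, the shape operator $A_N$ and the rotation form $\tau$ are given, for $X,Y$ tangent to $M$, by $\overline\nabla_XY=\nabla_XY+B(X,Y)N$ and $\overline\nabla_XN=-A_NX+\tau(X)N$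 with $\tau(X)=\overline g(\overline\nabla_XN,\xi)$; the screen shape operator $A^*_\xi$, with values in the screen distribution $\ker\eta$, is given by $\nabla_X\xi=-A^*_\xi X-\tau(X)\xi$. For a function $\alpha$ put $g_\alpha=g+\alpha\,\eta\otimes\eta$. Then $$\mathcal N_F=\frac1{2x^0}\Big[\frac{\partial}{\partial x^0}-\varepsilon^aF'_a\frac{\partial}{\partial x^a}\Big]$$ is a null rigging for $M$ whose rigged field is $\xi=-x^0\big[\frac{\partial}{\partial x^0}+\varepsilon^aF'_a\frac{\partial}{\partial x^a}\big]$. It is closed, that is, $d\eta=0$, and $\alpha=2(x^0)^2$ is constant along the screen distribution, that is, $d\alpha$ vanishes on $\ker\eta$. For $N=\mathcal N_F$ and this $\alpha$, $$A^*_\xi=\alpha A_N\qquad\text{and}\qquad\tau=\eta .$$ Hence the coincidence conditions $A^*_\xi=\alpha A_N$ and $2\alpha\,\tau(\xi)+d\alpha(\xi)=0$ hold; $g_\alpha$ is a semi-Riemannian metric on $M$ of index $q-1$, and the induced connection $\nabla$ is the Levi-Civita connection of $g_\alpha$. -/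

import Mathlib

open scoped ContDiff

noncomputable section

namespace NullRigging

/-- The coordinate space `ℝᵐ`, used both for points and for tangent vectors. -/
abbrev Coord (m : ℕ) : Type := Fin m → ℝ

/-! ### Metrics and connections on an open subset of `ℝᵐ` (one global chart) -/

/-- `g` is a semi-Riemannian metric of index `ν` on `U`: a smooth symmetric nondegenerate
`(0,2)`-tensor field of constant index `ν`. -/
structure IsSemiRiemannianMetric {m : ℕ} (U : Set (Coord m))
    (g : Coord m → LinearMap.BilinForm ℝ (Coord m)) (ν : ℕ) : Prop where
  smooth : ∀ v w : Coord m, ContDiffOn ℝ ∞ (fun u => g u v w) U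
  symm : ∀ u ∈ U, ∀ v w : Coord m, g u v w = g u w v
  nondegenerate : ∀ u ∈ U, (g u).Nondegenerate
  index : ∀ u ∈ U, sigNeg (LinearMap.BilinMap.toQuadraticMap (g u)) = ν

/-- `nabla` is an affine connection on `U`; vector fields on `U` are the maps `X` that are smooth
on `U`, and `nabla X Y` is the covariant derivative of `Y` along `X`. -/
structure IsConnection {m : ℕ} (U : Set (Coord m))
    (nabla : (Coord m → Coord m) → (Coord m → Coord m) → Coord m → Coord m) : Prop where
  smooth : ∀ X Y, ContDiffOn ℝ ∞ X U → ContDiffOn ℝ ∞ Y U → ContDiffOn ℝ ∞ (nabla X Y) U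
  add_left : ∀ X X' Y, ContDiffOn ℝ ∞ X U → ContDiffOn ℝ ∞ X' U → ContDiffOn ℝ ∞ Y U →
    ∀ u ∈ U, nabla (X + X') Y u = nabla X Y u + nabla X' Y u
  smul_left : ∀ (f : Coord m → ℝ) (X Y), ContDiffOn ℝ ∞ f U → ContDiffOn ℝ ∞ X U →
    ContDiffOn ℝ ∞ Y U → ∀ u ∈ U, nabla (fun p => f p • X p) Y u = f u • nabla X Y u
  add_right : ∀ X Y Y', ContDiffOn ℝ ∞ X U → ContDiffOn ℝ ∞ Y U → ContDiffOn ℝ ∞ Y' U →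
    ∀ u ∈ U, nabla X (Y + Y') u = nabla X Y u + nabla X Y' u
  leibniz : ∀ (f : Coord m → ℝ) (X Y), ContDiffOn ℝ ∞ f U → ContDiffOn ℝ ∞ X U →
    ContDiffOn ℝ ∞ Y U → ∀ u ∈ U,
      nabla X (fun p => f p • Y p) u = fderiv ℝ f u (X u) • Y u + f u • nabla X Y u

/-- `nabla` is a Levi-Civita connection of `g` on `U`: a torsion-free metric connection. -/
structure IsLeviCivita {m : ℕ} (U : Set (Coord m))
    (g : Coord m → LinearMap.BilinForm ℝ (Coord m))
    (nabla : (Coord m → Coord m) → (Coord m → Coord m) → Coord m → Coord m) : Prop where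
  connection : IsConnection U nabla
  torsion_free : ∀ X Y, ContDiffOn ℝ ∞ X U → ContDiffOn ℝ ∞ Y U → ∀ u ∈ U,
    nabla X Y u - nabla Y X u = VectorField.lieBracket ℝ X Y u
  metric : ∀ X Y Z, ContDiffOn ℝ ∞ X U → ContDiffOn ℝ ∞ Y U → ContDiffOn ℝ ∞ Z U → ∀ u ∈ U,
    fderiv ℝ (fun p => g p (Y p) (Z p)) u (X u) =
      g u (nabla X Y u) (Z u) + g u (Y u) (nabla X Z u)

/-! ### The semi-Euclidean space of dimension `n + 1` and index `q` -/

/-- The signs `ε_i`: `-1` for `i ≤ q - 1` and `+1` for `i ≥ q`. -/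
def eps (q i : ℕ) : ℝ := if i < q then -1 else 1

/-- The scalar product `∑ ε_i v^i w^i` of the semi-Euclidean space. -/
def ambientMetric (n q : ℕ) : LinearMap.BilinForm ℝ (Coord (n + 1)) :=
  Matrix.toBilin' (Matrix.diagonal fun i : Fin (n + 1) => eps q i)

lemma ambientMetric_apply (n q : ℕ) (v w : Coord (n + 1)) :
    ambientMetric n q v w = ∑ i : Fin (n + 1), eps q i * v i * w i := by
  simp only [ambientMetric, Matrix.toBilin'_apply', dotProduct, Matrix.mulVec_diagonal]
  exact Finset.sum_congr rfl fun i _ => by ring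

/-- The Levi-Civita connection of the semi-Euclidean space is componentwise differentiation, so the
covariant derivative of a field `V` along a parametrized hypersurface in the direction `v` at `u`
is `fderiv ℝ V u v`. -/
lemma isLeviCivita_ambient (n q : ℕ) :
    IsLeviCivita Set.univ (fun _ => ambientMetric n q) (fun X Y p => fderiv ℝ Y p (X p)) := by
  have hd : ∀ {k : ℕ} {Y : Coord (n + 1) → Coord k}, ContDiffOn ℝ ∞ Y Set.univ →
      ∀ p, DifferentiableAt ℝ Y p := fun h p =>
    (contDiffOn_univ.1 h).differentiable (by simp) p
  have hf : ∀ {f : Coord (n + 1) → ℝ}, ContDiffOn ℝ ∞ f Set.univ →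
      ∀ p, DifferentiableAt ℝ f p := fun h p =>
    (contDiffOn_univ.1 h).differentiable (by simp) p
  refine ⟨⟨?_, ?_, ?_, ?_, ?_⟩, ?_, ?_⟩
  · intro X Y hX hY
    rw [contDiffOn_univ] at *
    exact (hY.fderiv_right (m := ∞) (by simp)).clm_apply hX
  · intro X X' Y _ _ _ u _
    simp
  · intro f X Y _ _ _ u _
    simp
  · intro X Y Y' _ hY hY' u _
    rw [fderiv_add (hd hY u) (hd hY' u)]
    rfl
  · intro f X Y hf' _ hY u _
    rw [fderiv_fun_smul (hf hf' u) (hd hY u)]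
    simp [add_comm]
  · intro X Y _ _ u _
    rfl
  · intro X Y Z _ hY hZ u _
    simp only [ambientMetric_apply]
    have h1 : ∀ i, HasFDerivAt (fun p => Y p i)
        ((ContinuousLinearMap.proj i).comp (fderiv ℝ Y u)) u := fun i =>
      (hasFDerivAt_pi'.1 (hd hY u).hasFDerivAt) i
    have h2 : ∀ i, HasFDerivAt (fun p => Z p i)
        ((ContinuousLinearMap.proj i).comp (fderiv ℝ Z u)) u := fun i =>
      (hasFDerivAt_pi'.1 (hd hZ u).hasFDerivAt) i
    have h3 := HasFDerivAt.fun_sum (u := Finset.univ)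
      fun i (_ : i ∈ Finset.univ) => ((h1 i).const_mul (eps q i)).mul (h2 i)
    have h4 := congrArg (fun L => L (X u)) h3.fderiv
    simp only [Pi.mul_apply] at h4
    rw [h4, ← Finset.sum_add_distrib]
    simp only [sum_apply]
    refine Finset.sum_congr rfl fun i _ => ?_
    simp
    ring

/-! ### Rigged null hypersurfaces

A hypersurface is given by a parametrization `x` on an open set `D` of `ℝⁿ`, and `D` is identified
with its image. A tangent vector at `x u` is represented by its components `v` in the frame
`∂/∂u^1, …, ∂/∂u^n`, the corresponding ambient vector being `fderiv ℝ x u v`. -/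

section Hypersurface

variable {n : ℕ} (q : ℕ) (D : Set (Coord n)) (x : Coord n → Coord (n + 1))
  (N : Coord (n + 1) → Coord (n + 1)) (ξ : Coord n → Coord n) (α : Coord (n + 1) → ℝ)

/-- The induced tensor `g`, the pullback of the ambient metric. -/
def inducedMetric (u : Coord n) : LinearMap.BilinForm ℝ (Coord n) :=
  (ambientMetric n q).comp (fderiv ℝ x u).toLinearMap (fderiv ℝ x u).toLinearMap

/-- The hypersurface is null: the induced tensor `g` is degenerate at every point. -/
def IsNull : Prop :=
  ∀ u ∈ D, ∃ v : Coord n, v ≠ 0 ∧ ∀ w : Coord n, inducedMetric q x u v w = 0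

/-- `N` is a null rigging: a smooth vector field on an open set containing the hypersurface which,
at the points of the hypersurface, is transversal to it and lightlike. -/
def IsNullRigging : Prop :=
  (∃ O : Set (Coord (n + 1)), IsOpen O ∧ x '' D ⊆ O ∧ ContDiffOn ℝ ∞ N O) ∧
    ∀ u ∈ D, N (x u) ∉ Set.range (fderiv ℝ x u) ∧ ambientMetric n q (N (x u)) (N (x u)) = 0

/-- The `1`-form `η`, the pullback of the ambient `1`-form metrically equivalent to `N`. -/
def eta (u : Coord n) : Coord n →ₗ[ℝ] ℝ :=
  (ambientMetric n q (N (x u))).comp (fderiv ℝ x u).toLinearMap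

/-- `ξ` is the rigged vector field: the section of the radical of `g` with `⟨ξ, N⟩ = 1`. -/
def IsRiggedField : Prop :=
  ContDiffOn ℝ ∞ ξ D ∧ ∀ u ∈ D,
    (∀ w : Coord n, inducedMetric q x u (ξ u) w = 0) ∧
      ambientMetric n q (fderiv ℝ x u (ξ u)) (N (x u)) = 1

/-- The rigging is closed: `dη = 0`. -/
def IsClosedRigging : Prop :=
  ∀ u ∈ D, ∀ v w : Coord n,
    fderiv ℝ (fun p => eta q x N p w) u v - fderiv ℝ (fun p => eta q x N p v) u w = 0

/-- The linear map `(v, t) ↦ dx_u v + t N`; it is invertible when `dx_u` is injective and `N` is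
transversal, and its inverse is the decomposition of ambient vectors along `TM ⊕ span N`. -/
def splitting (u : Coord n) : (Coord n × ℝ) →L[ℝ] Coord (n + 1) :=
  (fderiv ℝ x u).coprod (ContinuousLinearMap.toSpanSingleton ℝ (N (x u)))

/-- The component tangent to the hypersurface of an ambient vector, in the decomposition along
`TM ⊕ span N`. -/
def tangentPart (u : Coord n) (V : Coord (n + 1)) : Coord n :=
  ((splitting x N u).inverse V).1

/-- The connection induced on the hypersurface by projection along `N`: the tangential component
of the ambient covariant derivative. -/
def inducedConnection (X Y : Coord n → Coord n) (u : Coord n) : Coord n :=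
  tangentPart x N u (fderiv ℝ (fun p => fderiv ℝ x p (Y p)) u (X u))

/-- The shape operator `A_N`: minus the tangential component of the covariant derivative of `N`. -/
def shapeOperator (u v : Coord n) : Coord n :=
  -tangentPart x N u (fderiv ℝ (fun p => N (x p)) u v)

/-- The rotation `1`-form `τ(v) = ⟨∇_v N, ξ⟩`. -/
def rotationForm (u v : Coord n) : ℝ :=
  ambientMetric n q (fderiv ℝ (fun p => N (x p)) u v) (fderiv ℝ x u (ξ u))

/-- The projection of the tangent space onto the screen `ker η` along `ξ`. -/
def screenProjection (u v : Coord n) : Coord n :=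
  v - eta q x N u v • ξ u

/-- The screen shape operator `A*_ξ`: minus the screen component of the induced covariant
derivative of `ξ` (`∇_v ξ = -A*_ξ v - τ(v) ξ`). -/
def screenShapeOperator (u v : Coord n) : Coord n :=
  -screenProjection q x N ξ u (inducedConnection x N (fun _ => v) ξ u)

/-- The `α`-associated metric `g_α = g + α η ⊗ η`. -/
def associatedMetric (u : Coord n) : LinearMap.BilinForm ℝ (Coord n) :=
  inducedMetric q x u +
    α (x u) • LinearMap.BilinForm.linMulLin (eta q x N u) (eta q x N u)

/-- `α` is constant along the screen distribution: `dα` vanishes on `ker η`. -/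
def IsConstantOnScreen : Prop :=
  ∀ u ∈ D, ∀ v : Coord n, eta q x N u v = 0 → fderiv ℝ (fun p => α (x p)) u v = 0

/-- The coincidence conditions `A*_ξ = α A_N` and `2 α τ(ξ) + dα(ξ) = 0`. -/
def CoincidenceConditions : Prop :=
  ∀ u ∈ D, (∀ v : Coord n, screenShapeOperator q x N ξ u v = α (x u) • shapeOperator x N u v) ∧
    2 * α (x u) * rotationForm q x N ξ u (ξ u) + fderiv ℝ (fun p => α (x p)) u (ξ u) = 0

end Hypersurface

/-! ### Monge hypersurfaces -/

/-- The parametrization `u ↦ (F(u), u^1, …, u^n)` of the Monge hypersurface of `F`. -/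
def mongeMap {n : ℕ} (F : Coord n → ℝ) (u : Coord n) : Coord (n + 1) :=
  Fin.cons (F u) u

/-- The partial derivative `∂F/∂u^a`. -/
def partialDeriv {n : ℕ} (F : Coord n → ℝ) (a : Fin n) (u : Coord n) : ℝ :=
  fderiv ℝ F u (Pi.single a 1)

/-- The rigging `(1/(2x^0)) [∂_0 - ε^a F'_a ∂_a]`, defined on `ℝ* × D`. -/
def specialRigging {n : ℕ} (q : ℕ) (F : Coord n → ℝ) (p : Coord (n + 1)) : Coord (n + 1) :=
  (1 / (2 * p 0)) •
    (Fin.cons 1 (fun a : Fin n => -(eps q (a + 1) * partialDeriv F a (Fin.tail p))) :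
      Coord (n + 1))

/-- The vector field `-x^0 [∂_0 + ε^a F'_a ∂_a]` along the Monge hypersurface of `F`; its
components in the frame `∂/∂u^a` are `-F ε^a F'_a`. -/
def specialRigged {n : ℕ} (q : ℕ) (F : Coord n → ℝ) (u : Coord n) : Coord n :=
  fun a => -(F u * (eps q (a + 1) * partialDeriv F a u))

/-- The function `α = 2 (x^0)²`. -/
def specialAlpha {n : ℕ} (p : Coord (n + 1)) : ℝ := 2 * p 0 ^ 2

end NullRigging

end

open NullRigging

noncomputable section

namespace NullRigging

/-! Let `h` be the scalar product of the hyperplane x⁰ = 0 and G the gradient of F with respect to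
`h`. The induced tensor is h - dF⊗dF, and it is degenerate exactly when dF(G) = 1, the eikonal
equation (`eikonal`). Differentiating this equation shows that the Hessian of F annihilates G
(`fderiv_fderiv_raise`). Everything else follows from these two facts.

Along M, N = (1, -G)/(2F), ξ = -F G and η = -dF/F. Hence α η⊗η = 2 dF⊗dF and g_α = h + dF⊗dF
(`associatedMetric_mongeMap`), which is isometric to `h` and so has index q - 1.

Since ∂_0 = ½ dx(G) + F N, the Gauss formula reads ∇_X Y = D_X Y + ½ Hess F(X, Y) G
(`inducedConnection_mongeMap`). It is torsion-free because the Hessian is symmetric, and metric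
because g_α(G, ·) = 2 dF. Differentiating N and ξ gives A_N v = D_v G/(2F) and A*_ξ v = F D_v G,
whose ratio is 2F² = α, and τ = -dF/F = η. -/

/-- The scalar product `∑ ε_a v^a w^a` of the coordinate hyperplane `x⁰ = 0`. -/
def hyperplaneMetric (n q : ℕ) : LinearMap.BilinForm ℝ (Coord n) :=
  Matrix.toBilin' (Matrix.diagonal fun a : Fin n => eps q (a + 1))

/-- The vector metrically equivalent to a covector, for the scalar product `∑ ε_a v^a w^a`. -/
def raise (n q : ℕ) : (Coord n →L[ℝ] ℝ) →L[ℝ] Coord n :=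
  ContinuousLinearMap.pi fun a => eps q (a + 1) • ContinuousLinearMap.apply ℝ ℝ (Pi.single a 1)

/-! ### Linear algebra of `h` and of its perturbation by the square of a unit covector. -/

section Algebra

variable {n q : ℕ}

lemma eps_mul_self (q i : ℕ) : eps q i * eps q i = 1 := by
  unfold eps; split_ifs <;> norm_num

lemma hyperplaneMetric_apply (v w : Coord n) :
    hyperplaneMetric n q v w = ∑ a : Fin n, eps q (a + 1) * v a * w a := by
  simp only [hyperplaneMetric, Matrix.toBilin'_apply', dotProduct, Matrix.mulVec_diagonal]
  exact Finset.sum_congr rfl fun i _ => by ring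

lemma hyperplaneMetric_comm (v w : Coord n) :
    hyperplaneMetric n q v w = hyperplaneMetric n q w v := by
  simp only [hyperplaneMetric_apply]
  exact Finset.sum_congr rfl fun i _ => by ring

lemma raise_apply (l : Coord n →L[ℝ] ℝ) (a : Fin n) :
    raise n q l a = eps q (a + 1) * l (Pi.single a 1) := rfl

lemma hyperplaneMetric_raise (l : Coord n →L[ℝ] ℝ) (v : Coord n) :
    hyperplaneMetric n q (raise n q l) v = l v := by
  rw [hyperplaneMetric_apply]
  conv_rhs => rw [← Finset.univ_sum_single v, map_sum]
  refine Finset.sum_congr rfl fun a _ => ?_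
  have h : (Pi.single a (v a) : Coord n) = v a • Pi.single a 1 := by
    rw [← Pi.single_smul, smul_eq_mul, mul_one]
  rw [h, map_smul, raise_apply, ← mul_assoc, eps_mul_self, smul_eq_mul, one_mul, mul_comm]

/-- The pairing of covectors by the scalar product is symmetric. -/
lemma apply_raise_comm (l l' : Coord n →L[ℝ] ℝ) : l (raise n q l') = l' (raise n q l) := by
  rw [← hyperplaneMetric_raise (q := q) l, hyperplaneMetric_comm, hyperplaneMetric_raise]

lemma eq_zero_of_hyperplaneMetric_eq_zero {v : Coord n}
    (h : ∀ w, hyperplaneMetric n q v w = 0) : v = 0 := by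
  ext a
  have h1 := h (raise n q (ContinuousLinearMap.proj a))
  rw [hyperplaneMetric_comm, hyperplaneMetric_raise] at h1
  exact h1

lemma ambientMetric_cons (hq : 1 ≤ q) (s t : ℝ) (v w : Coord n) :
    ambientMetric n q (Fin.cons s v : Coord (n + 1)) (Fin.cons t w : Coord (n + 1)) =
      -(s * t) + hyperplaneMetric n q v w := by
  rw [ambientMetric_apply, Fin.sum_univ_succ, hyperplaneMetric_apply]
  have h0 : eps q 0 = -1 := if_pos hq
  simp [h0]

lemma smul_cons (c s : ℝ) (v : Coord n) :
    c • (Fin.cons s v : Coord (n + 1)) = (Fin.cons (c * s) (c • v) : Coord (n + 1)) := by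
  ext i; refine Fin.cases ?_ (fun _ => ?_) i <;> simp

lemma cons_add_cons (s t : ℝ) (v w : Coord n) :
    (Fin.cons s v : Coord (n + 1)) + (Fin.cons t w : Coord (n + 1)) =
      (Fin.cons (s + t) (v + w) : Coord (n + 1)) := by
  ext i; refine Fin.cases ?_ (fun _ => ?_) i <;> simp

/-- Adding `θ ⊗ θ` to the scalar product, `θ` a covector of square `1`, gives an isometric scalar
product. -/
lemma hyperplaneMetric_add_equivalent (l : Coord n →L[ℝ] ℝ) (hl : l (raise n q l) = 1)
    (g : LinearMap.BilinForm ℝ (Coord n))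
    (hg : ∀ v w, g v w = hyperplaneMetric n q v w + l v * l w) :
    (LinearMap.BilinMap.toQuadraticMap g).Equivalent
      (LinearMap.BilinMap.toQuadraticMap (hyperplaneMetric n q)) := by
  have hs : √2 * √2 = (2 : ℝ) := Real.mul_self_sqrt (by norm_num)
  -- With G = `raise n q l`, the map `T c` fixes ker l and scales G by 1 + c. It pulls `h` back to h
  -- + ((1 + c)² - 1) l⊗l, so the isometry needs 1 + c = √2, and its inverse has factor √2/2.
  let T : ℝ → Coord n →ₗ[ℝ] Coord n := fun c =>
    LinearMap.id + (c • l.toLinearMap).smulRight (raise n q l)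
  have hT : ∀ c v, T c v = v + (c * l v) • raise n q l := fun c v => by
    simp [T]
  have hcomp : ∀ c d, c + d + c * d = 0 → ∀ v, T c (T d v) = v := by
    intro c d hcd v
    rw [hT, hT, map_add, map_smul, hl, add_assoc, ← add_smul]
    have : d * l v + c * (l v + (d * l v) • 1) = 0 := by
      simp only [smul_eq_mul]; linear_combination l v * hcd
    rw [this, zero_smul, add_zero]
  have h1 : (√2 - 1) + (√2 / 2 - 1) + (√2 - 1) * (√2 / 2 - 1) = 0 := by
    linear_combination hs / 2
  have h2 : (√2 / 2 - 1) + (√2 - 1) + (√2 / 2 - 1) * (√2 - 1) = 0 := by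
    linear_combination hs / 2
  let L : Coord n ≃ₗ[ℝ] Coord n := LinearEquiv.ofLinearMap (T (√2 - 1)) (T (√2 / 2 - 1))
    (LinearMap.ext (hcomp _ _ h1)) (LinearMap.ext (hcomp _ _ h2))
  refine ⟨{ L with map_app' := fun v => ?_ }⟩
  change hyperplaneMetric n q (T (√2 - 1) v) (T (√2 - 1) v) = g v v
  rw [hT, hg]
  simp only [map_add, map_smul, LinearMap.add_apply, LinearMap.smul_apply, smul_eq_mul,
    hyperplaneMetric_raise, hl]
  rw [hyperplaneMetric_comm v (raise n q l), hyperplaneMetric_raise]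
  linear_combination (l v) ^ 2 * hs

/-- The index `a : Fin n` stands for the coordinate x^(a+1). Since q ≥ 1 makes x⁰ negative, dropping
it leaves q - 1 minus signs; for q = 0 truncated subtraction gives the right value 0. -/
lemma sigNeg_hyperplaneMetric (hqn : q ≤ n + 1) :
    sigNeg (LinearMap.BilinMap.toQuadraticMap (hyperplaneMetric n q)) = q - 1 := by
  have h : LinearMap.BilinMap.toQuadraticMap (hyperplaneMetric n q) =
      QuadraticMap.weightedSumSquares ℝ fun a : Fin n => eps q (a + 1) := by
    ext v
    simp only [LinearMap.BilinMap.toQuadraticMap_apply, hyperplaneMetric_apply,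
      QuadraticMap.weightedSumSquares_apply, smul_eq_mul, mul_assoc]
  rw [h, QuadraticForm.sigNeg_weightedSumSquares]
  have h2 : {a : Fin n | eps q (a + 1) < 0} = {a : Fin n | (a : ℕ) < q - 1} := by
    ext a
    change (if (a : ℕ) + 1 < q then (-1 : ℝ) else 1) < 0 ↔ (a : ℕ) < q - 1
    split_ifs with h
    · exact iff_of_true (by norm_num) (by omega)
    · exact iff_of_false (by norm_num) (by omega)
  rw [h2, Set.ncard_eq_toFinset_card']
  simp [Fin.card_filter_val_lt]
  omega

lemma nondegenerate_of_eq_hyperplaneMetric_add (l : Coord n →L[ℝ] ℝ)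
    (hl : l (raise n q l) = 1) (g : LinearMap.BilinForm ℝ (Coord n))
    (hg : ∀ v w, g v w = hyperplaneMetric n q v w + l v * l w) : g.Nondegenerate := by
  refine LinearMap.BilinForm.Nondegenerate.ofSeparatingLeft ?_
  intro v hv
  -- Pairing v with the vector dual to l gives 2 l(v), so a vector in the radical lies in ker l,
  -- where `g` agrees with `h`.
  have h0 : l v = 0 := by
    have := hv (raise n q l)
    rw [hg, hyperplaneMetric_comm, hyperplaneMetric_raise, hl] at this
    linarith
  refine eq_zero_of_hyperplaneMetric_eq_zero (q := q) fun w => ?_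
  have := hv w
  rwa [hg, h0, zero_mul, add_zero] at this

end Algebra

/-! ### Uniqueness of the Levi-Civita connection and the splitting along TM ⊕ span N. -/

/-- Two Levi-Civita connections of a semi-Riemannian metric agree. -/
lemma IsLeviCivita.eq {m : ℕ} {U : Set (Coord m)}
    {g : Coord m → LinearMap.BilinForm ℝ (Coord m)} {ν : ℕ}
    (hg : IsSemiRiemannianMetric U g ν)
    {nabla nabla' : (Coord m → Coord m) → (Coord m → Coord m) → Coord m → Coord m}
    (h : IsLeviCivita U g nabla) (h' : IsLeviCivita U g nabla')
    {X Y : Coord m → Coord m} (hX : ContDiffOn ℝ ∞ X U) (hY : ContDiffOn ℝ ∞ Y U)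
    {u : Coord m} (hu : u ∈ U) : nabla X Y u = nabla' X Y u := by
  -- The difference of the connections at u, still as a function of vector fields: tensoriality is
  -- not needed. Absence of torsion makes it symmetric, and compatibility with the metric makes
  -- g(S(X, Y), Z) skew in Y and Z.
  let S : (Coord m → Coord m) → (Coord m → Coord m) → Coord m := fun X Y =>
    nabla X Y u - nabla' X Y u
  have hS : ∀ X Y, ContDiffOn ℝ ∞ X U → ContDiffOn ℝ ∞ Y U → S X Y = S Y X := by
    intro X Y hX hY
    have h1 := h.torsion_free X Y hX hY u hu
    rw [← h'.torsion_free X Y hX hY u hu] at h1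
    simp only [S]
    linear_combination (exp := 1) h1
  have hM : ∀ X Y Z, ContDiffOn ℝ ∞ X U → ContDiffOn ℝ ∞ Y U → ContDiffOn ℝ ∞ Z U →
      g u (S X Y) (Z u) = -g u (S X Z) (Y u) := by
    intro X Y Z hX hY hZ
    have h1 := h.metric X Y Z hX hY hZ u hu
    rw [h'.metric X Y Z hX hY hZ u hu, hg.symm u hu (Y u), hg.symm u hu (Y u)] at h1
    simp only [S, map_sub, LinearMap.sub_apply]
    linarith
  refine sub_eq_zero.1 ((hg.nondegenerate u hu).1 _ fun w => ?_)
  -- The vector w is extended to a constant field. Alternating skewness and symmetry three times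
  -- returns g(S(X, Y), w) to minus itself.
  have hZ : ContDiffOn ℝ ∞ (fun _ : Coord m => w) U := contDiffOn_const
  have e1 := hM X Y _ hX hY hZ
  have e2 := hM _ X Y hZ hX hY
  have e3 := hM Y _ X hY hZ hX
  rw [hS _ X hZ hX] at e2
  rw [hS Y _ hY hZ, hS Y X hY hX] at e3
  change g u (S X Y) w = 0
  linarith

/-- The tangential component in the decomposition `TM ⊕ span N`, read off from a decomposition. -/
lemma tangentPart_eq {n : ℕ} {x : Coord n → Coord (n + 1)} {N : Coord (n + 1) → Coord (n + 1)}
    {u : Coord n} (hinj : Function.Injective (fderiv ℝ x u))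
    (hN : N (x u) ∉ Set.range (fderiv ℝ x u)) (v : Coord n) (t : ℝ) :
    tangentPart x N u (fderiv ℝ x u v + t • N (x u)) = v := by
  have hs : ∀ v t, splitting x N u (v, t) = fderiv ℝ x u v + t • N (x u) := fun v t => by
    simp [splitting]
  have hi : Function.Injective (splitting x N u) := by
    rw [injective_iff_map_eq_zero]
    rintro ⟨v, t⟩ h
    rw [hs] at h
    have ht : t = 0 := by
      by_contra ht
      refine hN ⟨-(t⁻¹ • v), ?_⟩
      rw [map_neg, map_smul, eq_neg_of_add_eq_zero_left h, smul_neg, neg_neg, smul_smul,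
        inv_mul_cancel₀ ht, one_smul]
    rw [ht, zero_smul, add_zero] at h
    rw [ht, (map_eq_zero_iff _ hinj).1 h]
    rfl
  -- `inverse` is 0 on a non-invertible map, so invertibility must be exhibited; it follows from
  -- injectivity and equality of dimensions.
  have hfin : Module.finrank ℝ (Coord n × ℝ) = Module.finrank ℝ (Coord (n + 1)) := by simp
  let e : (Coord n × ℝ) ≃L[ℝ] Coord (n + 1) :=
    (LinearEquiv.ofInjectiveOfFinrankEq (splitting x N u).toLinearMap hi
      hfin).toContinuousLinearEquiv
  have he : (splitting x N u).IsInvertible := ⟨e, ContinuousLinearMap.ext fun _ => rfl⟩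
  rw [tangentPart, ← hs, he.inverse_apply_self]

/-! ### The null graph of F: eikonal equation, Weingarten and Gauss formulas, associated metric. -/

section Monge

variable {n q : ℕ} {D : Set (Coord n)} {F : Coord n → ℝ} {u : Coord n}

lemma specialRigging_mongeMap (u : Coord n) :
    specialRigging q F (mongeMap F u) =
      (Fin.cons (1 / (2 * F u)) (-((1 / (2 * F u)) • raise n q (fderiv ℝ F u))) :
        Coord (n + 1)) := by
  rw [specialRigging, mongeMap, Fin.tail_cons, Fin.cons_zero, smul_cons, mul_one, ← smul_neg]
  rfl

lemma specialRigged_eq (u : Coord n) :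
    specialRigged q F u = -(F u • raise n q (fderiv ℝ F u)) := rfl

lemma hasFDerivAt_cons {f : Coord n → ℝ} {f' : Coord n →L[ℝ] ℝ} {V : Coord n → Coord n}
    {V' : Coord n →L[ℝ] Coord n} (hf : HasFDerivAt f f' u) (hV : HasFDerivAt V V' u) :
    HasFDerivAt (fun p => (Fin.cons (f p) (V p) : Coord (n + 1))) (f'.finCons V') u :=
  hf.finCons hV

lemma hasFDerivAt_mongeMap (hF : DifferentiableAt ℝ F u) :
    HasFDerivAt (mongeMap F) ((fderiv ℝ F u).finCons (ContinuousLinearMap.id ℝ (Coord n))) u :=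
  hasFDerivAt_cons hF.hasFDerivAt (hasFDerivAt_id u)

lemma fderiv_mongeMap (hF : DifferentiableAt ℝ F u) (v : Coord n) :
    fderiv ℝ (mongeMap F) u v = (Fin.cons (fderiv ℝ F u v) v : Coord (n + 1)) := by
  rw [(hasFDerivAt_mongeMap hF).fderiv]
  rfl

lemma injective_fderiv_mongeMap (hF : DifferentiableAt ℝ F u) :
    Function.Injective (fderiv ℝ (mongeMap F) u) := by
  intro v w h
  rw [fderiv_mongeMap hF, fderiv_mongeMap hF] at h
  exact (Fin.cons_injective2 h).2

lemma inducedMetric_mongeMap (hq : 1 ≤ q) (hF : DifferentiableAt ℝ F u) (v w : Coord n) :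
    inducedMetric q (mongeMap F) u v w =
      -(fderiv ℝ F u v * fderiv ℝ F u w) + hyperplaneMetric n q v w := by
  change ambientMetric n q (fderiv ℝ (mongeMap F) u v) (fderiv ℝ (mongeMap F) u w) = _
  rw [fderiv_mongeMap hF, fderiv_mongeMap hF, ambientMetric_cons hq]

/-- A vector in the radical of the induced tensor is proportional to the gradient of `F`. -/
lemma eq_smul_raise_of_radical (hq : 1 ≤ q) (hF : DifferentiableAt ℝ F u) {v : Coord n}
    (hv : ∀ w, inducedMetric q (mongeMap F) u v w = 0) :
    v = fderiv ℝ F u v • raise n q (fderiv ℝ F u) := by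
  refine sub_eq_zero.1 (eq_zero_of_hyperplaneMetric_eq_zero (q := q) fun w => ?_)
  have h := hv w
  rw [inducedMetric_mongeMap hq hF] at h
  rw [map_sub, map_smul, LinearMap.sub_apply, LinearMap.smul_apply, hyperplaneMetric_raise,
    smul_eq_mul]
  linarith

/-- The eikonal equation: the graph of `F` is null only if the gradient of `F` has square `1`. -/
lemma eikonal (hq : 1 ≤ q) (hF : DifferentiableAt ℝ F u) {v : Coord n} (hv0 : v ≠ 0)
    (hv : ∀ w, inducedMetric q (mongeMap F) u v w = 0) :
    fderiv ℝ F u (raise n q (fderiv ℝ F u)) = 1 := by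
  have h := eq_smul_raise_of_radical hq hF hv
  have hd : fderiv ℝ F u v ≠ 0 := fun h0 => hv0 (by rw [h, h0, zero_smul])
  have h2 := congrArg (fderiv ℝ F u) h
  rw [map_smul, smul_eq_mul] at h2
  exact mul_left_cancel₀ hd (by rw [← h2, mul_one])

lemma eta_mongeMap (hq : 1 ≤ q) (hF : DifferentiableAt ℝ F u) (v : Coord n) :
    eta q (mongeMap F) (specialRigging q F) u v = -(fderiv ℝ F u v / F u) := by
  change ambientMetric n q (specialRigging q F (mongeMap F u)) (fderiv ℝ (mongeMap F) u v) = _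
  rw [fderiv_mongeMap hF, specialRigging_mongeMap, ambientMetric_cons hq, map_neg, map_smul,
    LinearMap.neg_apply, LinearMap.smul_apply, hyperplaneMetric_raise, smul_eq_mul]
  -- At a zero of F both sides vanish by the convention for division by 0.
  by_cases h : F u = 0
  · simp [h]
  · field_simp; ring

lemma specialRigging_notMem_range (hF : DifferentiableAt ℝ F u) (hF0 : F u ≠ 0)
    (he : fderiv ℝ F u (raise n q (fderiv ℝ F u)) = 1) :
    specialRigging q F (mongeMap F u) ∉ Set.range (fderiv ℝ (mongeMap F) u) := by
  rintro ⟨v, hv⟩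
  rw [fderiv_mongeMap hF, specialRigging_mongeMap] at hv
  obtain ⟨h1, h2⟩ := Fin.cons_injective2 hv
  -- The components along the hyperplane force v = -G/(2F), hence dF(v) = -1/(2F), whereas the x⁰
  -- component of N is +1/(2F).
  rw [h2, map_neg, map_smul, he] at h1
  simp only [smul_eq_mul] at h1
  field_simp at h1
  norm_num at h1

lemma ambientMetric_specialRigging (hq : 1 ≤ q)
    (he : fderiv ℝ F u (raise n q (fderiv ℝ F u)) = 1) :
    ambientMetric n q (specialRigging q F (mongeMap F u)) (specialRigging q F (mongeMap F u)) =
      0 := by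
  rw [specialRigging_mongeMap, ambientMetric_cons hq, map_neg, map_neg, map_smul, map_smul,
    LinearMap.neg_apply, LinearMap.smul_apply, hyperplaneMetric_raise, he]
  simp

/-- Reduces the computation of a tangential part to checking a proposed decomposition, so the
inverse of the splitting is never computed. -/
lemma tangentPart_mongeMap (hF : DifferentiableAt ℝ F u) (hF0 : F u ≠ 0)
    (he : fderiv ℝ F u (raise n q (fderiv ℝ F u)) = 1) {V : Coord (n + 1)} (v : Coord n) (t : ℝ)
    (hV : V = fderiv ℝ (mongeMap F) u v + t • specialRigging q F (mongeMap F u)) :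
    tangentPart (mongeMap F) (specialRigging q F) u V = v := by
  rw [hV]
  exact tangentPart_eq (injective_fderiv_mongeMap hF) (specialRigging_notMem_range hF hF0 he) v t

lemma differentiableAt_of_contDiffOn (hD : IsOpen D) {E : Type*} [NormedAddCommGroup E]
    [NormedSpace ℝ E] {f : Coord n → E} (hf : ContDiffOn ℝ ∞ f D) (hu : u ∈ D) :
    DifferentiableAt ℝ f u :=
  (hf.contDiffAt (hD.mem_nhds hu)).differentiableAt (by simp)

lemma contDiffOn_fderiv (hD : IsOpen D) {E : Type*} [NormedAddCommGroup E]
    [NormedSpace ℝ E] {f : Coord n → E} (hf : ContDiffOn ℝ ∞ f D) :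
    ContDiffOn ℝ ∞ (fderiv ℝ f) D :=
  hf.fderiv_of_isOpen hD (by simp)

/-- The Hessian of a solution of the eikonal equation annihilates the gradient. -/
lemma fderiv_fderiv_raise (hD : IsOpen D) (hF : ContDiffOn ℝ ∞ F D)
    (he : ∀ u ∈ D, fderiv ℝ F u (raise n q (fderiv ℝ F u)) = 1) (hu : u ∈ D) (v : Coord n) :
    fderiv ℝ (fderiv ℝ F) u v (raise n q (fderiv ℝ F u)) = 0 := by
  have hd := (differentiableAt_of_contDiffOn hD (contDiffOn_fderiv hD hF) hu).hasFDerivAt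
  have h1 := hd.clm_apply ((raise n q).hasFDerivAt.comp u hd)
  have h2 : HasFDerivAt (fun p => fderiv ℝ F p (raise n q (fderiv ℝ F p)))
      (0 : Coord n →L[ℝ] ℝ) u :=
    (hasFDerivAt_const (1 : ℝ) u).congr_of_eventuallyEq
      (Filter.eventually_of_mem (hD.mem_nhds hu) he)
  have h3 := congrArg (fun L => L v) (h1.unique h2)
  simp only [add_apply, ContinuousLinearMap.comp_apply,
    ContinuousLinearMap.flip_apply, Function.comp_apply, zero_apply] at h3
  -- The two terms of the product rule coincide, so twice the Hessian term is zero.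
  rw [apply_raise_comm (fderiv ℝ F u)] at h3
  linarith

/-- The Weingarten formula. Differentiating the factor 1/(2F) gives the multiple -dF(v)/F of N. The
remaining term (0, -D_v G/(2F)) is tangent to the graph because dF(D_v G) = Hess F(v, G) = 0. -/
lemma fderiv_specialRigging_mongeMap (hD : IsOpen D) (hF : ContDiffOn ℝ ∞ F D)
    (hF0 : ∀ u ∈ D, F u ≠ 0)
    (he : ∀ u ∈ D, fderiv ℝ F u (raise n q (fderiv ℝ F u)) = 1) (hu : u ∈ D) (v : Coord n) :
    fderiv ℝ (fun p => specialRigging q F (mongeMap F p)) u v =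
      fderiv ℝ (mongeMap F) u
        (-((1 / (2 * F u)) • raise n q (fderiv ℝ (fderiv ℝ F) u v))) +
      (-(fderiv ℝ F u v / F u)) • specialRigging q F (mongeMap F u) := by
  have hFu := hF0 u hu
  have hd := differentiableAt_of_contDiffOn hD hF hu
  have hd2 := (differentiableAt_of_contDiffOn hD (contDiffOn_fderiv hD hF) hu).hasFDerivAt
  have hG := (raise n q).hasFDerivAt.comp u hd2
  have hc : HasFDerivAt (fun p => 1 / (2 * F p)) ((-(1 / (2 * F u ^ 2))) • fderiv ℝ F u) u := by
    have := ((hasDerivAt_inv hFu).comp_hasFDerivAt u hd.hasFDerivAt).const_mul (1 / 2 : ℝ)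
    convert! this using 1
    · ext p; simp; ring
    · rw [smul_smul]; congr 1; field_simp
  have h := hasFDerivAt_cons hc (hc.smul hG).neg
  have heq : (fun p => specialRigging q F (mongeMap F p)) = fun p =>
      (Fin.cons (1 / (2 * F p)) (-((1 / (2 * F p)) • raise n q (fderiv ℝ F p))) :
        Coord (n + 1)) := funext fun p => specialRigging_mongeMap p
  have h' := congrArg (fun L => L v) (heq ▸ h.fderiv)
  refine h'.trans ?_
  rw [fderiv_mongeMap hd, specialRigging_mongeMap, smul_cons, cons_add_cons]
  change (Fin.cons ((-(1 / (2 * F u ^ 2))) • fderiv ℝ F u v)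
    (-((1 / (2 * F u)) • raise n q (fderiv ℝ (fderiv ℝ F) u v) +
      ((-(1 / (2 * F u ^ 2))) • fderiv ℝ F u v) • raise n q (fderiv ℝ F u))) :
        Coord (n + 1)) = _
  congr 1
  · rw [map_neg, map_smul, apply_raise_comm, fderiv_fderiv_raise hD hF he hu, smul_eq_mul]
    field_simp
    ring
  · have hk : (-(1 / (2 * F u ^ 2))) • fderiv ℝ F u v =
        -(fderiv ℝ F u v / F u * (1 / (2 * F u))) := by rw [smul_eq_mul]; field_simp
    rw [hk]
    module

/-- The Gauss formula for the graph of `F`. -/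
lemma inducedConnection_mongeMap (hD : IsOpen D) (hF : ContDiffOn ℝ ∞ F D)
    (hF0 : ∀ u ∈ D, F u ≠ 0)
    (he : ∀ u ∈ D, fderiv ℝ F u (raise n q (fderiv ℝ F u)) = 1) (hu : u ∈ D)
    (X : Coord n → Coord n) {Y : Coord n → Coord n} (hY : DifferentiableAt ℝ Y u) :
    inducedConnection (mongeMap F) (specialRigging q F) X Y u =
      fderiv ℝ Y u (X u) +
        (1 / 2 * fderiv ℝ (fderiv ℝ F) u (X u) (Y u)) • raise n q (fderiv ℝ F u) := by
  have hFu := hF0 u hu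
  have hd := differentiableAt_of_contDiffOn hD hF hu
  have hd2 := (differentiableAt_of_contDiffOn hD (contDiffOn_fderiv hD hF) hu).hasFDerivAt
  have h := hasFDerivAt_cons (hd2.clm_apply hY.hasFDerivAt) hY.hasFDerivAt
  have heq : (fun p => fderiv ℝ (mongeMap F) p (Y p)) =ᶠ[nhds u] fun p =>
      (Fin.cons (fderiv ℝ F p (Y p)) (Y p) : Coord (n + 1)) :=
    Filter.eventually_of_mem (hD.mem_nhds hu) fun p hp =>
      fderiv_mongeMap (differentiableAt_of_contDiffOn hD hF hp) _
  -- The ambient derivative is dx(D_X Y) + Hess F(X, Y) ∂_0, and ∂_0 = ½ dx(G) + F N supplies both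
  -- coefficients.
  refine tangentPart_mongeMap hd hFu (he u hu) _ (F u * fderiv ℝ (fderiv ℝ F) u (X u) (Y u)) ?_
  rw [heq.fderiv_eq]
  refine (congrArg (fun L => L (X u)) h.fderiv).trans ?_
  rw [fderiv_mongeMap hd, specialRigging_mongeMap, smul_cons, cons_add_cons]
  change (Fin.cons (fderiv ℝ F u (fderiv ℝ Y u (X u)) + fderiv ℝ (fderiv ℝ F) u (X u) (Y u))
    (fderiv ℝ Y u (X u)) : Coord (n + 1)) = _
  congr 1
  · rw [map_add, map_smul, he u hu, smul_eq_mul]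
    field_simp
    ring
  · rw [smul_neg, smul_smul, add_assoc, ← sub_eq_add_neg, ← sub_smul]
    have : 1 / 2 * fderiv ℝ (fderiv ℝ F) u (X u) (Y u) -
      F u * fderiv ℝ (fderiv ℝ F) u (X u) (Y u) * (1 / (2 * F u)) = 0 := by field_simp; ring
    rw [this, zero_smul, add_zero]

lemma fderiv_fderiv_comm (hD : IsOpen D) (hF : ContDiffOn ℝ ∞ F D) (hu : u ∈ D)
    (v w : Coord n) : fderiv ℝ (fderiv ℝ F) u v w = fderiv ℝ (fderiv ℝ F) u w v :=
  (hF.contDiffAt (hD.mem_nhds hu)).isSymmSndFDerivAt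
    (by simpa using WithTop.coe_le_coe.2 (le_top : (2 : ℕ∞) ≤ ⊤)) v w

/-- This accounts for the choice of α: 2F² cancels the denominators of η⊗η and changes the sign of
the dF⊗dF term of the induced tensor. -/
lemma associatedMetric_mongeMap (hq : 1 ≤ q) (hF : DifferentiableAt ℝ F u) (hF0 : F u ≠ 0)
    (v w : Coord n) :
    associatedMetric q (mongeMap F) (specialRigging q F) specialAlpha u v w =
      hyperplaneMetric n q v w + fderiv ℝ F u v * fderiv ℝ F u w := by
  change inducedMetric q (mongeMap F) u v w + (2 * F u ^ 2) *
    (eta q (mongeMap F) (specialRigging q F) u v * eta q (mongeMap F) (specialRigging q F) u w) = _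
  rw [inducedMetric_mongeMap hq hF, eta_mongeMap hq hF, eta_mongeMap hq hF]
  field_simp
  ring

lemma differentiableAt_and_fderiv_hyperplaneMetric {Y Z : Coord n → Coord n}
    (hY : DifferentiableAt ℝ Y u) (hZ : DifferentiableAt ℝ Z u) (v : Coord n) :
    DifferentiableAt ℝ (fun p => hyperplaneMetric n q (Y p) (Z p)) u ∧
    fderiv ℝ (fun p => hyperplaneMetric n q (Y p) (Z p)) u v =
      hyperplaneMetric n q (fderiv ℝ Y u v) (Z u) +
        hyperplaneMetric n q (Y u) (fderiv ℝ Z u v) := by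
  have h3 := HasFDerivAt.fun_sum (u := Finset.univ) fun a (_ : a ∈ Finset.univ) =>
    ((hasFDerivAt_pi'.1 hY.hasFDerivAt a).const_mul (eps q (a + 1))).mul
      (hasFDerivAt_pi'.1 hZ.hasFDerivAt a)
  simp only [hyperplaneMetric_apply]
  refine ⟨h3.differentiableAt, (congrArg (fun L => L v) h3.fderiv).trans ?_⟩
  rw [← Finset.sum_add_distrib, sum_apply]
  refine Finset.sum_congr rfl fun i _ => ?_
  simp
  ring

/-- The radical is spanned by G, and the normalization η(ξ) = 1 means dF(ξ) = -F. -/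
lemma eqOn_specialRigged (hq : 1 ≤ q) (hD : IsOpen D) (hF : ContDiffOn ℝ ∞ F D)
    (hF0 : ∀ u ∈ D, F u ≠ 0) {ξ : Coord n → Coord n}
    (hξ : IsRiggedField q D (mongeMap F) (specialRigging q F) ξ) :
    ∀ u ∈ D, ξ u = specialRigged q F u := by
  intro u hu
  obtain ⟨h1, h2⟩ := hξ.2 u hu
  have hd := differentiableAt_of_contDiffOn hD hF hu
  have h3 := eq_smul_raise_of_radical hq hd h1
  have h4 : eta q (mongeMap F) (specialRigging q F) u (ξ u) = 1 := by
    rw [← h2]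
    change ambientMetric n q _ _ = _
    simp only [ambientMetric_apply]
    exact Finset.sum_congr rfl fun i _ => by ring_nf; rfl
  rw [eta_mongeMap hq hd] at h4
  have h5 : fderiv ℝ F u (ξ u) = -F u := by
    have := hF0 u hu
    field_simp at h4
    linarith
  rw [h3, h5, specialRigged_eq, neg_smul]

end Monge

/-! ### The asserted properties of the rigging, its operators and the associated metric. -/

section SpecialRigging

variable {n q : ℕ} {D : Set (Coord n)} {F : Coord n → ℝ}

lemma contDiffOn_specialRigging (hD : IsOpen D) (hF : ContDiffOn ℝ ∞ F D) :
    ContDiffOn ℝ ∞ (specialRigging q F) {p : Coord (n + 1) | p 0 ≠ 0 ∧ Fin.tail p ∈ D} := by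
  have htail : ContDiff ℝ ∞ (Fin.tail : Coord (n + 1) → Coord n) :=
    contDiff_pi.2 fun a => contDiff_apply ℝ ℝ a.succ
  have h0 : ContDiff ℝ ∞ (fun p : Coord (n + 1) => 2 * p 0) :=
    contDiff_const.mul (contDiff_apply ℝ ℝ 0)
  refine (contDiffOn_const.div h0.contDiffOn fun p hp => mul_ne_zero two_ne_zero hp.1).smul
    (contDiffOn_pi.2 fun i => ?_)
  refine Fin.cases contDiffOn_const (fun a => ?_) i
  exact (contDiffOn_const.mul (((contDiffOn_fderiv hD hF).comp htail.contDiffOn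
    fun p hp => hp.2).clm_apply contDiffOn_const)).neg

lemma isNullRigging_special (hq : 1 ≤ q) (hD : IsOpen D) (hF : ContDiffOn ℝ ∞ F D)
    (hF0 : ∀ u ∈ D, F u ≠ 0)
    (he : ∀ u ∈ D, fderiv ℝ F u (raise n q (fderiv ℝ F u)) = 1) :
    IsNullRigging q D (mongeMap F) (specialRigging q F) := by
  refine ⟨⟨{p | p 0 ≠ 0 ∧ Fin.tail p ∈ D}, ?_, ?_, contDiffOn_specialRigging hD hF⟩,
    fun u hu => ⟨specialRigging_notMem_range (differentiableAt_of_contDiffOn hD hF hu)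
      (hF0 u hu) (he u hu), ambientMetric_specialRigging hq (he u hu)⟩⟩
  · have htail : Continuous (Fin.tail : Coord (n + 1) → Coord n) :=
      continuous_pi fun a => continuous_apply a.succ
    exact (isOpen_ne.preimage (continuous_apply (0 : Fin (n + 1)))).inter (hD.preimage htail)
  · rintro _ ⟨u, hu, rfl⟩
    exact ⟨hF0 u hu, hu⟩

lemma isRiggedField_special (hq : 1 ≤ q) (hD : IsOpen D) (hF : ContDiffOn ℝ ∞ F D)
    (hF0 : ∀ u ∈ D, F u ≠ 0)
    (he : ∀ u ∈ D, fderiv ℝ F u (raise n q (fderiv ℝ F u)) = 1) :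
    IsRiggedField q D (mongeMap F) (specialRigging q F) (specialRigged q F) := by
  refine ⟨(hF.smul ((raise n q).contDiff.comp_contDiffOn (contDiffOn_fderiv hD hF))).neg,
    fun u hu => ⟨fun w => ?_, ?_⟩⟩
  · rw [inducedMetric_mongeMap hq (differentiableAt_of_contDiffOn hD hF hu), specialRigged_eq,
      map_neg, map_smul, he u hu, map_neg, map_smul, LinearMap.neg_apply, LinearMap.smul_apply,
      hyperplaneMetric_raise, smul_eq_mul, smul_eq_mul]
    ring
  · rw [fderiv_mongeMap (differentiableAt_of_contDiffOn hD hF hu), specialRigging_mongeMap,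
      ambientMetric_cons hq, specialRigged_eq, map_neg, map_smul, he u hu, map_neg, map_smul,
      map_neg, map_smul, LinearMap.neg_apply, LinearMap.smul_apply, hyperplaneMetric_raise,
      he u hu]
    have := hF0 u hu
    simp only [smul_eq_mul]
    field_simp
    norm_num

/-- Here η = -d log|F|, so the claim comes down to the symmetry of the Hessian of F. -/
lemma isClosedRigging_special (hq : 1 ≤ q) (hD : IsOpen D) (hF : ContDiffOn ℝ ∞ F D)
    (hF0 : ∀ u ∈ D, F u ≠ 0) :
    IsClosedRigging q D (mongeMap F) (specialRigging q F) := by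
  intro u hu
  have key : ∀ v w : Coord n,
      fderiv ℝ (fun p => eta q (mongeMap F) (specialRigging q F) p w) u v =
        -((fderiv ℝ (fderiv ℝ F) u v w * F u - fderiv ℝ F u w * fderiv ℝ F u v) / F u ^ 2) := by
    intro v w
    have heq : (fun p => eta q (mongeMap F) (specialRigging q F) p w) =ᶠ[nhds u]
        fun p => -(fderiv ℝ F p w * (F p)⁻¹) :=
      Filter.eventually_of_mem (hD.mem_nhds hu) fun p hp =>
        (eta_mongeMap hq (differentiableAt_of_contDiffOn hD hF hp) w).trans
          (by rw [div_eq_mul_inv])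
    have h := ((((differentiableAt_of_contDiffOn hD (contDiffOn_fderiv hD hF)
      hu).hasFDerivAt.clm_apply (hasFDerivAt_const w u)).mul
      ((hasDerivAt_inv (hF0 u hu)).comp_hasFDerivAt u
        (differentiableAt_of_contDiffOn hD hF hu).hasFDerivAt)).neg)
    rw [heq.fderiv_eq]
    refine (congrArg (fun L => L v) h.fderiv).trans ?_
    have := hF0 u hu
    simp
    field_simp
    ring
  intro v w
  rw [key, key, fderiv_fderiv_comm hD hF hu v w]
  ring

lemma fderiv_specialAlpha_mongeMap {u : Coord n} (hF : DifferentiableAt ℝ F u) (v : Coord n) :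
    fderiv ℝ (fun p => specialAlpha (mongeMap F p)) u v = 4 * F u * fderiv ℝ F u v := by
  have h := (hF.hasFDerivAt.pow 2).const_mul 2
  refine (congrArg (fun L => L v) h.fderiv).trans ?_
  simp
  ring

lemma isConstantOnScreen_special (hq : 1 ≤ q) (hD : IsOpen D) (hF : ContDiffOn ℝ ∞ F D)
    (hF0 : ∀ u ∈ D, F u ≠ 0) :
    IsConstantOnScreen q D (mongeMap F) (specialRigging q F) specialAlpha := by
  intro u hu v hv
  have hd := differentiableAt_of_contDiffOn hD hF hu
  rw [eta_mongeMap hq hd, neg_eq_zero, div_eq_zero_iff, or_iff_left (hF0 u hu)] at hv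
  rw [fderiv_specialAlpha_mongeMap hd, hv, mul_zero]

lemma shapeOperator_special (hD : IsOpen D) (hF : ContDiffOn ℝ ∞ F D)
    (hF0 : ∀ u ∈ D, F u ≠ 0)
    (he : ∀ u ∈ D, fderiv ℝ F u (raise n q (fderiv ℝ F u)) = 1) {u : Coord n} (hu : u ∈ D)
    (v : Coord n) :
    shapeOperator (mongeMap F) (specialRigging q F) u v =
      (1 / (2 * F u)) • raise n q (fderiv ℝ (fderiv ℝ F) u v) := by
  rw [shapeOperator, tangentPart_mongeMap (differentiableAt_of_contDiffOn hD hF hu) (hF0 u hu)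
    (he u hu) _ _ (fderiv_specialRigging_mongeMap hD hF hF0 he hu v), neg_neg]

/-- D_v ξ = -(F D_v G + dF(v) G). The Gauss correction vanishes because ξ is a multiple of G, and
the screen projection removes the G term while keeping D_v G, on which dF vanishes. -/
lemma screenShapeOperator_special (hq : 1 ≤ q) (hD : IsOpen D) (hF : ContDiffOn ℝ ∞ F D)
    (hF0 : ∀ u ∈ D, F u ≠ 0)
    (he : ∀ u ∈ D, fderiv ℝ F u (raise n q (fderiv ℝ F u)) = 1) {ξ : Coord n → Coord n}
    (hξ : ∀ u ∈ D, ξ u = specialRigged q F u) {u : Coord n} (hu : u ∈ D) (v : Coord n) :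
    screenShapeOperator q (mongeMap F) (specialRigging q F) ξ u v =
      F u • raise n q (fderiv ℝ (fderiv ℝ F) u v) := by
  have hd := differentiableAt_of_contDiffOn hD hF hu
  have hd2 := (differentiableAt_of_contDiffOn hD (contDiffOn_fderiv hD hF) hu).hasFDerivAt
  have h : HasFDerivAt ξ _ u :=
    ((hd.hasFDerivAt.smul ((raise n q).hasFDerivAt.comp u hd2)).neg).congr_of_eventuallyEq
      (Filter.eventually_of_mem (hD.mem_nhds hu) hξ)
  have hv : fderiv ℝ ξ u v = -(F u • raise n q (fderiv ℝ (fderiv ℝ F) u v) +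
      fderiv ℝ F u v • raise n q (fderiv ℝ F u)) := congrArg (fun L => L v) h.fderiv
  rw [screenShapeOperator, inducedConnection_mongeMap hD hF hF0 he hu _ h.differentiableAt, hv,
    hξ u hu, specialRigged_eq, screenProjection, map_neg, map_smul,
    fderiv_fderiv_raise hD hF he hu, smul_zero, neg_zero, mul_zero, zero_smul, add_zero, hξ u hu,
    specialRigged_eq, eta_mongeMap hq hd, map_neg, map_add, map_smul, map_smul, he u hu,
    apply_raise_comm, fderiv_fderiv_raise hD hF he hu]
  have hc : -(-(F u • (0 : ℝ) + fderiv ℝ F u v • (1 : ℝ)) / F u) * F u = fderiv ℝ F u v := by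
    have := hF0 u hu
    simp only [smul_eq_mul]
    field_simp
    ring
  rw [smul_neg, smul_smul, hc]
  module

/-- Pairing with ξ kills the tangential part in the Weingarten formula and leaves the coefficient of
N. -/
lemma rotationForm_special (hq : 1 ≤ q) (hD : IsOpen D) (hF : ContDiffOn ℝ ∞ F D)
    (hF0 : ∀ u ∈ D, F u ≠ 0)
    (he : ∀ u ∈ D, fderiv ℝ F u (raise n q (fderiv ℝ F u)) = 1) {ξ : Coord n → Coord n}
    (hξ : ∀ u ∈ D, ξ u = specialRigged q F u) {u : Coord n} (hu : u ∈ D) (v : Coord n) :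
    rotationForm q (mongeMap F) (specialRigging q F) ξ u v =
      eta q (mongeMap F) (specialRigging q F) u v := by
  have hd := differentiableAt_of_contDiffOn hD hF hu
  have hFu := hF0 u hu
  rw [rotationForm, fderiv_specialRigging_mongeMap hD hF hF0 he hu, eta_mongeMap hq hd,
    fderiv_mongeMap hd, fderiv_mongeMap hd, hξ u hu, specialRigged_eq, specialRigging_mongeMap,
    smul_cons, cons_add_cons, ambientMetric_cons hq]
  simp only [map_neg, map_smul, map_add, LinearMap.add_apply, LinearMap.neg_apply,
    LinearMap.smul_apply, hyperplaneMetric_raise, he u hu, apply_raise_comm (fderiv ℝ F u),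
    fderiv_fderiv_raise hD hF he hu, smul_eq_mul]
  field_simp
  ring

lemma isSemiRiemannianMetric_special (hq : 1 ≤ q) (hqn : q ≤ n + 1) (hD : IsOpen D)
    (hF : ContDiffOn ℝ ∞ F D) (hF0 : ∀ u ∈ D, F u ≠ 0)
    (he : ∀ u ∈ D, fderiv ℝ F u (raise n q (fderiv ℝ F u)) = 1) :
    IsSemiRiemannianMetric D
      (associatedMetric q (mongeMap F) (specialRigging q F) specialAlpha) (q - 1) := by
  have hg : ∀ u ∈ D, ∀ v w,
      associatedMetric q (mongeMap F) (specialRigging q F) specialAlpha u v w =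
        hyperplaneMetric n q v w + fderiv ℝ F u v * fderiv ℝ F u w := fun u hu =>
    associatedMetric_mongeMap hq (differentiableAt_of_contDiffOn hD hF hu) (hF0 u hu)
  refine ⟨fun v w => ?_, fun u hu v w => ?_, fun u hu => ?_, fun u hu => ?_⟩
  · have hdF := contDiffOn_fderiv hD hF
    exact (contDiffOn_const.add ((hdF.clm_apply contDiffOn_const).mul
      (hdF.clm_apply contDiffOn_const))).congr fun u hu => hg u hu v w
  · rw [hg u hu, hg u hu, hyperplaneMetric_comm, mul_comm]
  · exact nondegenerate_of_eq_hyperplaneMetric_add _ (he u hu) _ (hg u hu)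
  · rw [(hyperplaneMetric_add_equivalent _ (he u hu) _ (hg u hu)).sigNeg_eq,
      sigNeg_hyperplaneMetric hqn]

/-- Compatibility with the metric rests on g_α(G, ·) = 2 dF: the factor 2 cancels the ½ of the Gauss
formula, and the correction terms become the derivative of dF⊗dF. -/
lemma isLeviCivita_special (hq : 1 ≤ q) (hD : IsOpen D) (hF : ContDiffOn ℝ ∞ F D)
    (hF0 : ∀ u ∈ D, F u ≠ 0)
    (he : ∀ u ∈ D, fderiv ℝ F u (raise n q (fderiv ℝ F u)) = 1) :
    IsLeviCivita D (associatedMetric q (mongeMap F) (specialRigging q F) specialAlpha)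
      (inducedConnection (mongeMap F) (specialRigging q F)) := by
  have hdiff : ∀ {Y : Coord n → Coord n}, ContDiffOn ℝ ∞ Y D → ∀ u ∈ D, DifferentiableAt ℝ Y u :=
    fun hY u hu => differentiableAt_of_contDiffOn hD hY hu
  have hnab : ∀ {Y : Coord n → Coord n}, ContDiffOn ℝ ∞ Y D → ∀ X, ∀ u ∈ D,
      inducedConnection (mongeMap F) (specialRigging q F) X Y u = fderiv ℝ Y u (X u) +
        (1 / 2 * fderiv ℝ (fderiv ℝ F) u (X u) (Y u)) • raise n q (fderiv ℝ F u) :=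
    fun hY X u hu => inducedConnection_mongeMap hD hF hF0 he hu X (hdiff hY u hu)
  have hdF := contDiffOn_fderiv hD hF
  refine ⟨⟨?_, ?_, ?_, ?_, ?_⟩, ?_, ?_⟩
  · intro X Y hX hY
    exact (((contDiffOn_fderiv hD hY).clm_apply hX).add ((contDiffOn_const.mul
      (((contDiffOn_fderiv hD hdF).clm_apply hX).clm_apply hY)).smul
      ((raise n q).contDiff.comp_contDiffOn hdF))).congr (hnab hY X)
  · intro X X' Y _ _ hY u hu
    rw [hnab hY _ u hu, hnab hY _ u hu, hnab hY _ u hu]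
    simp only [Pi.add_apply, map_add, add_apply]
    module
  · intro f X Y _ _ hY u hu
    rw [hnab hY _ u hu, hnab hY _ u hu]
    simp only [map_smul, smul_apply, smul_eq_mul]
    module
  · intro X Y Y' _ hY hY' u hu
    rw [hnab (Y := Y + Y') (hY.add hY') _ u hu, hnab hY _ u hu, hnab hY' _ u hu,
      fderiv_add (hdiff hY u hu) (hdiff hY' u hu)]
    simp only [Pi.add_apply, map_add, add_apply]
    module
  · intro f X Y hf _ hY u hu
    rw [hnab (Y := fun p => f p • Y p) (hf.smul hY) _ u hu, hnab hY _ u hu,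
      fderiv_fun_smul (differentiableAt_of_contDiffOn hD hf hu) (hdiff hY u hu)]
    simp only [map_smul, smul_apply, add_apply, ContinuousLinearMap.smulRight_apply, smul_eq_mul]
    module
  · intro X Y hX hY u hu
    rw [hnab hY _ u hu, hnab hX _ u hu, fderiv_fderiv_comm hD hF hu (Y u), VectorField.lieBracket]
    module
  · intro X Y Z hX hY hZ u hu
    have hd := differentiableAt_of_contDiffOn hD hF hu
    have hd2 := (differentiableAt_of_contDiffOn hD hdF hu).hasFDerivAt
    have heq : (fun p => associatedMetric q (mongeMap F) (specialRigging q F) specialAlpha p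
        (Y p) (Z p)) =ᶠ[nhds u] fun p => hyperplaneMetric n q (Y p) (Z p) +
          fderiv ℝ F p (Y p) * fderiv ℝ F p (Z p) :=
      Filter.eventually_of_mem (hD.mem_nhds hu) fun p hp =>
        associatedMetric_mongeMap hq (differentiableAt_of_contDiffOn hD hF hp) (hF0 p hp) _ _
    obtain ⟨h1, h2⟩ := differentiableAt_and_fderiv_hyperplaneMetric (q := q)
      (hdiff hY u hu) (hdiff hZ u hu) (X u)
    have h3 := (hd2.clm_apply (hdiff hY u hu).hasFDerivAt).mul
      (hd2.clm_apply (hdiff hZ u hu).hasFDerivAt)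
    have h4 := congrArg (fun L => L (X u)) (h1.hasFDerivAt.add h3).fderiv
    rw [heq.fderiv_eq]
    refine h4.trans ?_
    rw [add_apply, h2, hnab hY _ u hu, hnab hZ _ u hu,
      associatedMetric_mongeMap hq hd (hF0 u hu), associatedMetric_mongeMap hq hd (hF0 u hu)]
    simp only [map_add, map_smul, LinearMap.add_apply, LinearMap.smul_apply,
      hyperplaneMetric_raise, he u hu, hyperplaneMetric_comm (Y u) (raise n q _), add_apply,
      smul_apply, ContinuousLinearMap.comp_apply, ContinuousLinearMap.flip_apply, smul_eq_mul]
    ring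

end SpecialRigging

end NullRigging

end

open NullRigging
theorem mainTheorem12 (n q : ℕ) (hq : 1 ≤ q) (hqn : q ≤ n + 1)
    (D : Set (Coord n)) (hD : IsOpen D)
    (F : Coord n → ℝ) (hF : ContDiffOn ℝ ∞ F D) (hF0 : ∀ u ∈ D, F u ≠ 0)
    (hnull : IsNull q D (mongeMap F)) :
    IsNullRigging q D (mongeMap F) (specialRigging q F) ∧
    IsRiggedField q D (mongeMap F) (specialRigging q F) (specialRigged q F) ∧
    IsClosedRigging q D (mongeMap F) (specialRigging q F) ∧
    IsConstantOnScreen q D (mongeMap F) (specialRigging q F) specialAlpha ∧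
    (∀ ξ : Coord n → Coord n, IsRiggedField q D (mongeMap F) (specialRigging q F) ξ →
      (∀ u ∈ D, ξ u = specialRigged q F u) ∧
      (∀ u ∈ D, ∀ v : Coord n,
        screenShapeOperator q (mongeMap F) (specialRigging q F) ξ u v =
          (2 * F u ^ 2) • shapeOperator (mongeMap F) (specialRigging q F) u v) ∧
      (∀ u ∈ D, ∀ v : Coord n,
        rotationForm q (mongeMap F) (specialRigging q F) ξ u v =
          eta q (mongeMap F) (specialRigging q F) u v) ∧
      CoincidenceConditions q D (mongeMap F) (specialRigging q F) ξ specialAlpha) ∧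
    IsSemiRiemannianMetric D
      (associatedMetric q (mongeMap F) (specialRigging q F) specialAlpha) (q - 1) ∧
    IsLeviCivita D (associatedMetric q (mongeMap F) (specialRigging q F) specialAlpha)
      (inducedConnection (mongeMap F) (specialRigging q F)) ∧
    (∀ nabla : (Coord n → Coord n) → (Coord n → Coord n) → Coord n → Coord n,
      IsLeviCivita D (associatedMetric q (mongeMap F) (specialRigging q F) specialAlpha) nabla →
      ∀ X Y : Coord n → Coord n, ContDiffOn ℝ ∞ X D → ContDiffOn ℝ ∞ Y D →
        ∀ u ∈ D, inducedConnection (mongeMap F) (specialRigging q F) X Y u = nabla X Y u) := by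
  -- Nullity enters only through the eikonal equation.
  have he : ∀ u ∈ D, fderiv ℝ F u (raise n q (fderiv ℝ F u)) = 1 := fun u hu =>
    let ⟨_, hv0, hv⟩ := hnull u hu
    eikonal hq (differentiableAt_of_contDiffOn hD hF hu) hv0 hv
  have hmetric := isSemiRiemannianMetric_special hq hqn hD hF hF0 he
  have hlc := isLeviCivita_special hq hD hF hF0 he
  refine ⟨isNullRigging_special hq hD hF hF0 he, isRiggedField_special hq hD hF hF0 he,
    isClosedRigging_special hq hD hF hF0, isConstantOnScreen_special hq hD hF hF0,
    fun ξ hξ => ?_, hmetric, hlc, fun nabla hnabla X Y hX hY u hu =>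
      hlc.eq hmetric hnabla hX hY hu⟩
  have hξ' := eqOn_specialRigged hq hD hF hF0 hξ
  have hA : ∀ u ∈ D, ∀ v : Coord n,
      screenShapeOperator q (mongeMap F) (specialRigging q F) ξ u v =
        (2 * F u ^ 2) • shapeOperator (mongeMap F) (specialRigging q F) u v := by
    intro u hu v
    have := hF0 u hu
    rw [screenShapeOperator_special hq hD hF hF0 he hξ' hu, shapeOperator_special hD hF hF0 he hu,
      smul_smul]
    congr 1
    field_simp
  have hτ : ∀ u ∈ D, ∀ v : Coord n, rotationForm q (mongeMap F) (specialRigging q F) ξ u v =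
      eta q (mongeMap F) (specialRigging q F) u v :=
    fun u hu v => rotationForm_special hq hD hF hF0 he hξ' hu v
  refine ⟨hξ', hA, hτ, fun u hu => ⟨hA u hu, ?_⟩⟩
  have hd := differentiableAt_of_contDiffOn hD hF hu
  have := hF0 u hu
  rw [hτ u hu, eta_mongeMap hq hd, fderiv_specialAlpha_mongeMap hd]
  -- Since τ = -dF/F and dα = 4F dF, the form 2ατ + dα vanishes on every vector, in particular on ξ.
  change 2 * (2 * F u ^ 2) * _ + _ = 0
  field_simp
  ring
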